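/- Let $V$ be a finite set, let $s\neq t$ be elements of $V$, and let $c:V\times V\to\mathbb{R}_{\ge 0}$ be symmetric and satisfy the triangle inequality. Let $E=\binom{V}{2}$; for $U\subseteq V$ let $\delta(U)$ be the set of edges in $E$ with exactly one endpoint in $U$, and $\delta(v):=\delta(\{v\})$. For $x\in\mathbb{R}^E$ and $F\subseteq E$ write $x(F)=\sum_{e\in F}x_e$, $c(x)=\sum_{e=\{v,w\}\in E}c(v,w)x_e$, and $c(F)=c(\chi^F)$, where $\chi^F$ is the incidence vector of $F$. Let $\mathcal{S}$ be the set of edge sets of spanning trees of the complete graph $(V,E)$. For $S\in\mathcal{S}$ let $I_S\subseteq S$ be the edge set of the $s$-$t$-path in $(V,S)$, and let $T_S$ be the set of those $v\in V\setminus\{s,t\}$ for which $|\delta(v)\cap S|$ is odd together with those $v\in\{s,t\}$ for which $|\delta(v)\cap S|$ is even. A $T_S$-join is a set $J\subseteq E$ such that $|\delta(v)\cap J|$ is odd for $v\in T_S$ and even for $v\in V\setminus T_S$. Let $x^*\in\mathbb{R}^E_{\ge 0}$ be a feasible (for example, an optimal) solution of the linear programming relaxation of the $s$-$t$-path TSP,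 which is to minimize $c(x)$ over all $x\in\mathbb{R}^E_{\ge 0}$ with $x(\delta(U))\ge 2$ for all $\emptyset\ne U\subsetneq V$ with $|U\cap\{s,t\}|$ even, $x(\delta(U))\ge 1$ for all $\emptyset\neq U\subsetneq V$ with $|U\cap\{s,t\}|$ odd, $x(\delta(v))=2$ for $v\in V\setminus\{s,t\}$, and $x(\delta(s))=x(\delta(t))=1$. Let $p$ be a distribution on $\mathcal{S}$ (that is, $p_S\ge 0$ for all $S\in\mathcal{S}$ and $\sum_{S\in\mathcal{S}}p_S=1$) with $x^*=\sum_{S\in\mathcal{S}}p_S\chi^S$, and let $$\mathrm{BOMC}(p):=\min_{S\in\mathcal{S}:\,p_S>0}\bigl(c(S)+\min\{c(J):J\text{ is a }T_S\text{-join}\}\bigr).$$ Let $\mathcal{C}=\{\delta(U):\emptyset\ne U\subsetneq V,\ x^*(\delta(U))<2\}$ be the set of narrow cuts, and for $C\in\mathcal{C}$ let $p^C_{\mathrm{even}}=\sum_{S\in\mathcal{S}:\,|S\cap C|\text{ even}}p_S$. For every $S\in\mathcal{S}$ and $C\in\mathcal{C}$ let an edge $e^S_C\in I_S\cap C$ be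 chosen. Let $0\le\beta<\frac12$, and let $0\le\gamma_{S,e}\le 1$ for $S\in\mathcal{S}$ and $e\in I_S$. For $S\in\mathcal{S}$ and $C\in\mathcal{C}$ define the benefit $$b_{S,C}:=\begin{cases}\min\left\{\frac{\beta(2-x^*(C))}{1-2\beta},\ \gamma_{S,e^S_C}\right\}&\text{if }|S\cap C|\text{ is even},\\ 1-\gamma_{S,e^S_C}&\text{if }|S\cap C|=1,\\ 0&\text{otherwise.}\end{cases}$$ If $$\sum_{S\in\mathcal{S}}p_S\,b_{S,C}\ \ge\ \frac{\beta(2-x^*(C))\,p^C_{\mathrm{even}}}{1-2\beta}\qquad\text{for all }C\in\mathcal{C},$$ then $\mathrm{BOMC}(p)\le(2-\beta)\,c(x^*)$. -/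

import Mathlib

/-- An instance of the metric `s`-`t`-path TSP on the finite vertex set `V`: two distinct vertices
`s`, `t` and a symmetric nonnegative distance function satisfying the triangle inequality. -/
structure STPathInstance (V : Type*) where
  s : V
  t : V
  s_ne_t : s ≠ t
  dist : V → V → ℝ
  dist_symm : ∀ v w, dist v w = dist w v
  dist_nonneg : ∀ v w, 0 ≤ dist v w
  dist_triangle : ∀ u v w, dist u w ≤ dist u v + dist v w

namespace STPathInstance

variable {V : Type*} [Fintype V] [DecidableEq V]

/-- The edge set `E` of the complete graph on `V`: all unordered pairs of distinct vertices. -/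
def edges (V : Type*) [Fintype V] [DecidableEq V] : Finset (Sym2 V) :=
  Finset.univ.filter (fun e => ¬ e.IsDiag)

/-- The cut `δ(U)`: the edges with exactly one endpoint in `U`. -/
def cut (U : Finset V) : Finset (Sym2 V) :=
  Finset.univ.filter (fun e => ∃ v ∈ U, ∃ w ∉ U, e = s(v, w))

/-- The degree `|δ(v) ∩ F|` of the vertex `v` in the edge set `F`. -/
def degreeIn (F : Finset (Sym2 V)) (v : V) : ℕ :=
  (cut {v} ∩ F).card

/-- A vector `x` in `ℝ^E` is given by a function on `Sym2 V`, of which only the values on `E` are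
ever used; `vecSum x F` is `x(F) = ∑_{e ∈ F} x_e`. -/
def vecSum (x : Sym2 V → ℝ) (F : Finset (Sym2 V)) : ℝ :=
  ∑ e ∈ F, x e

/-- The incidence vector `χ^F`. -/
def incidence (F : Finset (Sym2 V)) (e : Sym2 V) : ℝ :=
  if e ∈ F then 1 else 0

open Classical in
/-- The set `𝒮` of edge sets of spanning trees of the complete graph on `V`. -/
noncomputable def spanningTrees (V : Type*) [Fintype V] [DecidableEq V] :
    Finset (Finset (Sym2 V)) :=
  (edges V).powerset.filter
    (fun S => (SimpleGraph.fromEdgeSet (S : Set (Sym2 V))).IsTree)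

/-- `J ⊆ E` is a `T`-join: `T` is exactly the set of vertices of odd degree in `J`. -/
def IsTJoin (T : Finset V) (J : Finset (Sym2 V)) : Prop :=
  J ⊆ edges V ∧ (∀ v ∈ T, Odd (degreeIn J v)) ∧ (∀ v ∉ T, Even (degreeIn J v))

open Classical in
/-- The finite set of all `T`-joins. -/
noncomputable def tJoins (T : Finset V) : Finset (Finset (Sym2 V)) :=
  (edges V).powerset.filter (fun J => IsTJoin T J)

/-- `p` is a distribution on `𝒮`. -/
def IsDistribution (p : Finset (Sym2 V) → ℝ) : Prop :=
  (∀ S ∈ spanningTrees V, 0 ≤ p S) ∧ ∑ S ∈ spanningTrees V, p S = 1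

/-- `x = ∑_{S ∈ 𝒮} p_S χ^S` as vectors in `ℝ^E`. -/
def Represents (p : Finset (Sym2 V) → ℝ) (x : Sym2 V → ℝ) : Prop :=
  ∀ e ∈ edges V, x e = ∑ S ∈ spanningTrees V, p S * incidence S e

open Classical in
/-- The set `𝒞` of narrow cuts: the cuts `δ(U)` with `∅ ≠ U ⊂ V` and `x(δ(U)) < 2`. -/
noncomputable def narrowCuts (x : Sym2 V → ℝ) : Finset (Finset (Sym2 V)) :=
  (Finset.univ.filter
    (fun U : Finset V => U.Nonempty ∧ U ⊂ Finset.univ ∧ vecSum x (cut U) < 2)).image cut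

/-- `p^C_even`: the total probability of the trees that contain an even number of edges of `C`. -/
noncomputable def pEven (p : Finset (Sym2 V) → ℝ) (C : Finset (Sym2 V)) : ℝ :=
  ∑ S ∈ (spanningTrees V).filter (fun S => Even (S ∩ C).card), p S

/-- The cost of a (possible) edge. -/
def edgeCost (I : STPathInstance V) (e : Sym2 V) : ℝ :=
  Sym2.lift ⟨I.dist, I.dist_symm⟩ e

/-- `c(x) = ∑_{e ∈ E} c(e) x_e` for a vector `x`. -/
def cost (I : STPathInstance V) (x : Sym2 V → ℝ) : ℝ :=
  ∑ e ∈ edges V, I.edgeCost e * x e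

/-- `c(F) = c(χ^F)` for an edge set `F`. -/
def setCost (I : STPathInstance V) (F : Finset (Sym2 V)) : ℝ :=
  I.cost (incidence F)

/-- `x` is a feasible solution of the linear programming relaxation of the `s`-`t`-path TSP. -/
structure Feasible (I : STPathInstance V) (x : Sym2 V → ℝ) : Prop where
  cut_even : ∀ U : Finset V, U.Nonempty → U ⊂ Finset.univ →
    Even (U ∩ {I.s, I.t}).card → 2 ≤ vecSum x (cut U)
  cut_odd : ∀ U : Finset V, U.Nonempty → U ⊂ Finset.univ →
    Odd (U ∩ {I.s, I.t}).card → 1 ≤ vecSum x (cut U)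
  degree_inner : ∀ v : V, v ≠ I.s → v ≠ I.t → vecSum x (cut {v}) = 2
  degree_s : vecSum x (cut {I.s}) = 1
  degree_t : vecSum x (cut {I.t}) = 1
  nonneg : ∀ e ∈ edges V, 0 ≤ x e

/-- `T_S`: the vertices whose degree in `S` has the wrong parity (even for `s` and `t`, odd for
all other vertices). -/
def wrongParity (I : STPathInstance V) (S : Finset (Sym2 V)) : Finset V :=
  Finset.univ.filter (fun v =>
    (v ≠ I.s ∧ v ≠ I.t ∧ Odd (degreeIn S v)) ∨ ((v = I.s ∨ v = I.t) ∧ Even (degreeIn S v)))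

open Classical in
/-- `I_S`: the edge set of the (for a spanning tree `S`: unique) `s`-`t`-path in `(V, S)`. -/
noncomputable def pathEdges (I : STPathInstance V) (S : Finset (Sym2 V)) : Finset (Sym2 V) :=
  S.filter (fun e => ∃ P : (SimpleGraph.fromEdgeSet (S : Set (Sym2 V))).Walk I.s I.t,
    P.IsPath ∧ e ∈ P.edges)

open Classical in
/-- `BOMC(p) = min_{S ∈ 𝒮, p_S > 0} (c(S) + min {c(J) : J is a T_S-join})`, the cost of the result
of the best-of-many Christofides algorithm. The minima over finite sets are taken in `ℝ ∪ {+∞}`,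
so that a minimum over the empty set would be `+∞`. -/
noncomputable def bomc (I : STPathInstance V) (p : Finset (Sym2 V) → ℝ) : WithTop ℝ :=
  ((spanningTrees V).filter (fun S => 0 < p S)).inf (fun S =>
    ((I.setCost S : ℝ) : WithTop ℝ) +
      (tJoins (I.wrongParity S)).inf (fun J => ((I.setCost J : ℝ) : WithTop ℝ)))

/-- The benefit `b_{S,C}` of a spanning tree `S` and a narrow cut `C`, for the vector `x`, the
number `β`, the numbers `γ_{S,e} = γ S e` and the chosen edges `e^S_C = ε S C`. -/
noncomputable def benefit (x : Sym2 V → ℝ) (β : ℝ) (γ : Finset (Sym2 V) → Sym2 V → ℝ)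
    (ε : Finset (Sym2 V) → Finset (Sym2 V) → Sym2 V) (S C : Finset (Sym2 V)) : ℝ :=
  if Even (S ∩ C).card then min (β * (2 - vecSum x C) / (1 - 2 * β)) (γ S (ε S C))
  else if (S ∩ C).card = 1 then 1 - γ S (ε S C)
  else 0

end STPathInstance

/-! By averaging over `p`, it suffices to give each tree S a nonnegative vector y_S with y_S(C) ≥ 1
on every T_S-cut C and to bound the mean of c(S) + c(y_S): by Edmonds and Johnson a cheapest
T_S-join costs at most c(y_S) (`exists_tJoin_le`).

Take y_S = βx* + (1-2β)(χ^{S∖I_S} + γ_S on I_S + Σ_C R_{S,C} χ^{m_C}), where m_C is a cheapest edge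
of the narrow cut C. Since S∖I_S is a T_S-join, it meets every T_S-cut, so a cut with x*(C) ≥ 2
receives at least 2β + (1-2β) = 1. A narrow T_S-cut separates s from t, which forces |S∩C| to be
even; its shortage β(2-x*(C)) is covered by γ on e^S_C and, where that is too little, by the deficit
R_{S,C} (`one_le_vecSum_correction`).

For each C, the benefit hypothesis says that the mean deficit is at most the mean of 1-γ over trees
with |S∩C| = 1 (`sum_deficit_le`). Such a tree saves (1-γ)c(e^S_C) ≥ (1-γ)c(m_C), and distinct cuts
of this kind use distinct edges (`sum_released_le`). So the savings pay for the deficits, and the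
mean is at most (1 + β + (1-2β))c(x*).

The T-join theorem is proved by dual ascent: while a minimum join has positive cost, some cut
meeting it in one edge can be cheapened without destroying its optimality (`exists_reduction`). That
cut is the star at the end of a shortest path in the graph with zero-cost edges contracted. -/

set_option linter.unusedSectionVars false

open scoped symmDiff

/-! ### Edge sets modulo 2: boundaries, paths and circuits in multigraphs with loops -/

namespace TJoin

variable {E W : Type*} [Fintype E] [DecidableEq E] [DecidableEq W]

/-- The indicator vector of a vertex over `ZMod 2`. -/
def vtx (v : W) : W → ZMod 2 := Pi.single v 1

/-- The mod 2 boundary of an edge set of the multigraph with endpoint map `g`. -/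
def bd (g : E → W × W) (F : Finset E) : W → ZMod 2 :=
  ∑ e ∈ F, (vtx (g e).1 + vtx (g e).2)

/-- The edges with exactly one end in `U`. -/
def gcut (g : E → W × W) (U : Finset W) : Finset E :=
  Finset.univ.filter (fun e => ¬((g e).1 ∈ U ↔ (g e).2 ∈ U))

theorem mem_gcut {g : E → W × W} {U : Finset W} {e : E} :
    e ∈ gcut g U ↔ ¬((g e).1 ∈ U ↔ (g e).2 ∈ U) := by simp [gcut]

theorem add_self_zero (x : W → ZMod 2) : x + x = 0 := by
  funext v; exact CharTwo.add_self_eq_zero _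

@[simp] theorem vtx_self (v : W) : vtx v v = 1 := by simp [vtx]

theorem vtx_ne {v u : W} (h : u ≠ v) : vtx v u = 0 := by simp [vtx, h]

theorem zmod_cases (x : ZMod 2) : x = 0 ∨ x = 1 := by
  revert x; decide

theorem bd_union {g : E → W × W} {F G : Finset E} (h : Disjoint F G) :
    bd g (F ∪ G) = bd g F + bd g G := Finset.sum_union h

theorem bd_insert {g : E → W × W} {F : Finset E} {e : E} (h : e ∉ F) :
    bd g (insert e F) = bd g {e} + bd g F := by
  simp [bd, Finset.sum_insert h]

theorem bd_sdiff {g : E → W × W} {F P : Finset E} (h : P ⊆ F) :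
    bd g (F \ P) = bd g F + bd g P := by
  have h1 : bd g (F \ P) + bd g P = bd g F := Finset.sum_sdiff h
  rw [← h1, add_assoc, add_self_zero, add_zero]

theorem bd_inter_add {g : E → W × W} (F G : Finset E) :
    bd g (F ∩ G) + bd g (F \ G) = bd g F := Finset.sum_inter_add_sum_sdiff F G _

theorem bd_symmDiff {g : E → W × W} (F G : Finset E) :
    bd g (F ∆ G) = bd g F + bd g G := by
  have h : F ∆ G = (F \ G) ∪ (G \ F) := rfl
  rw [h, bd_union disjoint_sdiff_sdiff, ← bd_inter_add F G, ← bd_inter_add G F,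
    Finset.inter_comm G F]
  have := add_self_zero (bd g (F ∩ G))
  calc bd g (F \ G) + bd g (G \ F)
      = (bd g (F ∩ G) + bd g (F ∩ G)) + (bd g (F \ G) + bd g (G \ F)) := by rw [this, zero_add]
    _ = _ := by abel

theorem sum_bd {g : E → W × W} (F : Finset E) (U : Finset W) :
    ∑ v ∈ U, bd g F v = ((F ∩ gcut g U).card : ZMod 2) := by
  have h1 : ∀ v, bd g F v = ∑ e ∈ F, (vtx (g e).1 v + vtx (g e).2 v) := by
    intro v; simp [bd, Finset.sum_apply]
  simp only [h1]
  rw [Finset.sum_comm, Finset.card_eq_sum_ones, Nat.cast_sum]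
  rw [← Finset.filter_mem_eq_inter, Finset.sum_filter]
  refine Finset.sum_congr rfl fun e _ => ?_
  have h2 : ∀ a : W, ∑ v ∈ U, vtx a v = if a ∈ U then 1 else 0 := by
    intro a; simp [vtx]
  rw [Finset.sum_add_distrib, h2, h2]
  have h11 : (1 : ZMod 2) + 1 = 0 := by decide
  by_cases ha : (g e).1 ∈ U <;> by_cases hb : (g e).2 ∈ U <;> simp [mem_gcut, ha, hb, h11]

theorem bd_apply {g : E → W × W} (F : Finset E) (v : W) :
    bd g F v = ((F ∩ gcut g {v}).card : ZMod 2) := by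
  simpa using sum_bd (g := g) F {v}

theorem exists_edge_of_bd {g : E → W × W} {F : Finset E} {v : W} (h : bd g F v = 1) :
    ∃ e ∈ F, e ∈ gcut g {v} := by
  by_contra! hc
  rw [bd_apply, Finset.card_eq_zero.2] at h
  · simp at h
  · ext e; simpa using hc e

theorem bd_zero_of_no_edge {g : E → W × W} {F : Finset E} {v : W}
    (h : ∀ e ∈ F, e ∉ gcut g {v}) : bd g F v = 0 := by
  rcases zmod_cases (bd g F v) with h0 | h1
  · exact h0
  · obtain ⟨e, he, hv⟩ := exists_edge_of_bd h1
    exact absurd hv (h e he)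

theorem bd_singleton_of_mem {g : E → W × W} {e : E} {b : W} (h : e ∈ gcut g {b}) :
    ∃ z, z ≠ b ∧ bd g {e} = vtx b + vtx z := by
  simp only [mem_gcut, Finset.mem_singleton] at h
  by_cases h1 : (g e).1 = b
  · exact ⟨(g e).2, by tauto, by simp [bd, h1]⟩
  · exact ⟨(g e).1, h1, by
      have : (g e).2 = b := by tauto
      simp [bd, this, add_comm]⟩

theorem bd_singleton_of_mem_mem {g : E → W × W} {e : E} {b v : W} (h : e ∈ gcut g {b})
    (hv : e ∈ gcut g {v}) (hbv : v ≠ b) : bd g {e} = vtx b + vtx v := by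
  simp only [mem_gcut, Finset.mem_singleton] at h hv
  by_cases h1 : (g e).1 = b
  · have h2 : (g e).2 = v := by
      by_contra h2
      have : (g e).1 = v := by tauto
      exact hbv (this.symm.trans h1)
    simp [bd, h1, h2]
  · have h2 : (g e).2 = b := by tauto
    have h3 : (g e).1 = v := by
      by_contra h3
      have : (g e).2 = v := by tauto
      exact hbv (this.symm.trans h2)
    simp [bd, h2, h3, add_comm]

/-- An odd vertex of an edge set is joined inside it to another odd vertex. -/
theorem exists_subjoin {g : E → W × W} {F : Finset E} {u : W} (h : bd g F u = 1) :
    ∃ P ⊆ F, ∃ v, v ≠ u ∧ bd g F v = 1 ∧ bd g P = vtx u + vtx v := by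
  classical
  -- A maximal P replaces a walk from `u`: if it stopped at an unsuitable vertex, an odd number of
  -- edges of `F \ P` would remain there, and one of them would extend it.
  obtain ⟨P, hP, hmax⟩ := Finset.exists_max_image
    (F.powerset.filter (fun P => ∃ v, bd g P = vtx u + vtx v)) Finset.card
    ⟨∅, by simpa using ⟨u, by simp [bd, add_self_zero]⟩⟩
  simp only [Finset.mem_filter, Finset.mem_powerset] at hP hmax
  obtain ⟨hPF, v, hv⟩ := hP
  by_cases hgood : v ≠ u ∧ bd g F v = 1
  · exact ⟨P, hPF, v, hgood.1, hgood.2, hv⟩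
  exfalso
  have h1 : bd g (F \ P) v = 1 := by
    rw [bd_sdiff hPF, hv]
    by_cases hvu : v = u
    · subst hvu
      simp [h, add_self_zero]
    · have : bd g F v = 0 := by
        rcases zmod_cases (bd g F v) with h0 | h1
        · exact h0
        · exact absurd ⟨hvu, h1⟩ hgood
      simp [this, vtx_ne hvu]
  obtain ⟨e, he, hev⟩ := exists_edge_of_bd h1
  rw [Finset.mem_sdiff] at he
  obtain ⟨z, -, hz⟩ := bd_singleton_of_mem hev
  have := hmax (insert e P) ⟨Finset.insert_subset he.1 hPF, z, by
    rw [bd_insert he.2, hv, hz]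
    calc vtx v + vtx z + (vtx u + vtx v) = vtx u + vtx z + (vtx v + vtx v) := by abel
      _ = _ := by rw [add_self_zero, add_zero]⟩
  rw [Finset.card_insert_of_notMem he.2] at this
  omega

/-- A join of two vertices without closed part has only one edge at its end. -/
theorem card_end_eq_one {g : E → W × W} {R : Finset E} {a b : W} (hab : a ≠ b)
    (hR : bd g R = vtx a + vtx b) (hc : ∀ A ⊆ R, bd g A = 0 → A = ∅) :
    (R ∩ gcut g {b}).card = 1 := by
  have hsub : ∀ A ⊆ R, bd g A = bd g R → A = R := by
    intro A hA h
    have := hc (R \ A) Finset.sdiff_subset (by rw [bd_sdiff hA, h, add_self_zero])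
    exact Finset.Subset.antisymm hA (Finset.sdiff_eq_empty_iff_subset.1 this)
  obtain ⟨e, heR, heb⟩ := exists_edge_of_bd (g := g) (F := R) (v := b) (by
    simp [hR, vtx_ne hab.symm])
  obtain ⟨u, hub, hu⟩ := bd_singleton_of_mem heb
  by_cases hua : u = a
  · have := hsub {e} (by simpa using heR) (by rw [hu, hR, hua, add_comm])
    rw [← this, Finset.inter_eq_left.2 (by simpa using heb)]
    simp
  have hRu : bd g R u = 0 := by simp [hR, vtx_ne hua, vtx_ne hub]
  have hsplit := bd_inter_add (g := g) R (gcut g {b})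
  -- Either a second edge is parallel to `e`, giving a closed pair, or the path continues from `u`
  -- away from the star of `b`. In the latter case it reaches `a`, or a vertex from which a second
  -- edge returns to `b` and closes a circuit.
  rcases zmod_cases (bd g (R \ gcut g {b}) u) with h0 | h1
  · exfalso
    have h2 : bd g (R ∩ gcut g {b}) u = 0 := by
      have := congrFun hsplit u
      simpa [h0, hRu] using this
    have h3 : bd g ((R ∩ gcut g {b}) \ {e}) u = 1 := by
      rw [bd_sdiff (by simp [heR, heb])]
      simp [h2, hu, vtx_ne hub]
    obtain ⟨e', he', heu⟩ := exists_edge_of_bd h3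
    simp only [Finset.mem_sdiff, Finset.mem_inter, Finset.mem_singleton] at he'
    have h4 := bd_singleton_of_mem_mem he'.1.2 heu hub
    have := hc (insert e' {e}) (by
      intro x; simp only [Finset.mem_insert, Finset.mem_singleton]
      rintro (rfl | rfl)
      · exact he'.1.1
      · exact heR) (by rw [bd_insert (by simpa using he'.2), h4, hu, add_self_zero])
    simp at this
  · obtain ⟨P, hP, v, hvu, hv1, hPv⟩ := exists_subjoin h1
    have heP : e ∉ P := fun h => (Finset.mem_sdiff.1 (hP h)).2 heb
    have hPR : P ⊆ R := hP.trans Finset.sdiff_subset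
    by_cases hva : v = a
    · have h2 := hsub (insert e P) (Finset.insert_subset heR hPR) (by
        rw [bd_insert heP, hu, hPv, hR, hva]
        calc vtx b + vtx u + (vtx u + vtx a) = vtx a + vtx b + (vtx u + vtx u) := by abel
          _ = _ := by rw [add_self_zero, add_zero])
      rw [Finset.card_eq_one]
      refine ⟨e, ?_⟩
      ext x
      rw [← h2]
      simp only [Finset.mem_inter, Finset.mem_insert, Finset.mem_singleton]
      constructor
      · rintro ⟨rfl | hx, hxb⟩
        · rfl
        · exact absurd hxb (Finset.mem_sdiff.1 (hP hx)).2
      · rintro rfl; exact ⟨Or.inl rfl, heb⟩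
    · exfalso
      have hvb : v ≠ b := by
        rintro rfl
        rw [bd_zero_of_no_edge (fun e he => (Finset.mem_sdiff.1 he).2)] at hv1
        exact zero_ne_one hv1
      have hRv : bd g R v = 0 := by simp [hR, vtx_ne hva, vtx_ne hvb]
      have h2 : bd g (R ∩ gcut g {b}) v = 1 := by
        have := congrFun hsplit v
        simp only [Pi.add_apply, hv1, hRv] at this
        rcases zmod_cases (bd g (R ∩ gcut g {b}) v) with h | h
        · rw [h] at this; simp at this
        · exact h
      obtain ⟨e', he', hev⟩ := exists_edge_of_bd h2
      rw [Finset.mem_inter] at he'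
      have h4 := bd_singleton_of_mem_mem he'.2 hev hvb
      have hne : e ≠ e' := by
        rintro rfl
        have := congrFun (h4.symm.trans hu) v
        simp [vtx_ne hvb, vtx_ne hvu] at this
      have he'P : e' ∉ P := fun h => (Finset.mem_sdiff.1 (hP h)).2 he'.2
      have := hc (insert e (insert e' P))
        (Finset.insert_subset heR (Finset.insert_subset he'.1 hPR)) (by
          rw [bd_insert (by simp [hne, heP]), bd_insert he'P, hu, h4, hPv]
          calc vtx b + vtx u + (vtx b + vtx v + (vtx u + vtx v))
              = (vtx b + vtx b) + (vtx u + vtx u) + (vtx v + vtx v) := by abel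
            _ = 0 := by simp only [add_self_zero, add_zero])
      simp at this

/-- Two vertices touched by a minimal closed edge set are joined inside it. -/
theorem exists_join_in_circuit {g : E → W × W} {F : Finset E} (hF : bd g F = 0)
    (hmin : ∀ A ⊆ F, bd g A = 0 → A = ∅ ∨ A = F) {b v : W} {e e' : E}
    (he : e ∈ F) (heb : e ∈ gcut g {b}) (he' : e' ∈ F) (hev : e' ∈ gcut g {v}) :
    ∃ P ⊆ F, bd g P = vtx b + vtx v := by
  classical
  let X : W → Prop := fun u => ∃ P ⊆ F, bd g P = vtx b + vtx u
  have hXb : X b := ⟨∅, by simp, by simp [bd, add_self_zero]⟩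
  have hstep : ∀ e ∈ F, ∀ u z, bd g {e} = vtx u + vtx z → X u → X z := by
    rintro e he u z huz ⟨P, hP, hPu⟩
    refine ⟨P ∆ {e}, ?_, ?_⟩
    · intro x hx
      rcases Finset.mem_symmDiff.1 hx with h | h
      · exact hP h.1
      · rw [Finset.mem_singleton.1 h.1]; exact he
    · rw [bd_symmDiff, hPu, huz]
      calc vtx b + vtx u + (vtx u + vtx z) = vtx b + vtx z + (vtx u + vtx u) := by abel
        _ = _ := by rw [add_self_zero, add_zero]
  have hends : ∀ e ∈ F, (X (g e).1 ↔ X (g e).2) := fun e he =>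
    ⟨hstep e he _ _ (by simp [bd]), hstep e he _ _ (by simp [bd, add_comm])⟩
  have hadj : ∀ e ∈ F, ∀ u, e ∈ gcut g {u} → (X (g e).1 ↔ X u) := by
    intro e he u hu
    simp only [mem_gcut, Finset.mem_singleton] at hu
    by_cases h1 : (g e).1 = u
    · rw [h1]
    · have : (g e).2 = u := by tauto
      rw [hends e he, this]
  -- The edges of `F` in the component of `b` form a closed set, so by minimality they are all of
  -- `F`.
  have hFX : bd g (F.filter (fun e => X (g e).1)) = 0 := by
    funext u
    by_cases hu : X u
    · have : bd g (F \ F.filter (fun e => X (g e).1)) u = 0 := by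
        refine bd_zero_of_no_edge fun e he heu => ?_
        simp only [Finset.mem_sdiff, Finset.mem_filter, not_and] at he
        exact he.2 he.1 ((hadj e he.1 u heu).2 hu)
      rw [bd_sdiff (Finset.filter_subset _ _), hF] at this
      simpa using this
    · refine bd_zero_of_no_edge fun e he heu => ?_
      rw [Finset.mem_filter] at he
      exact hu ((hadj e he.1 u heu).1 he.2)
  have heX : e ∈ F.filter (fun e => X (g e).1) :=
    Finset.mem_filter.2 ⟨he, (hadj e he b heb).2 hXb⟩
  rcases hmin _ (Finset.filter_subset _ _) hFX with h | h
  · rw [h] at heX; simp at heX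
  · rw [← h] at he'
    rw [Finset.mem_filter] at he'
    exact (hadj e' he'.1 v hev).1 he'.2

end TJoin

/-! ### Shortest paths for conservative weights -/

namespace TJoin

variable {E W : Type*} [Fintype E] [DecidableEq E] [DecidableEq W]

/-- A minimal closed edge set containing the edge `f` has at most one more edge at an end of `f`. -/
theorem circuit_star {g : E → W × W} {F : Finset E} (hF : bd g F = 0)
    (hmin : ∀ A ⊆ F, bd g A = 0 → A = ∅ ∨ A = F) {b : W} {f : E} (hf : f ∈ F)
    (hfb : f ∈ gcut g {b}) : ((F \ {f}) ∩ gcut g {b}).card = 1 := by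
  obtain ⟨u, hub, hu⟩ := bd_singleton_of_mem hfb
  refine card_end_eq_one hub ?_ ?_
  · rw [bd_sdiff (by simpa using hf), hF, hu, zero_add, add_comm]
  · intro A hA h0
    rcases hmin A (hA.trans Finset.sdiff_subset) h0 with h | h
    · exact h
    · rw [h] at hA
      have := hA hf
      simp at this

/-- The ends are not prescribed and may coincide, so that every shortened or extended path is a
competitor. The tie-break by cardinality excludes removable pieces of weight zero. -/
theorem exists_shortest_join [Fintype W] (g : E → W × W) (w : E → ℝ) (u : W) :
    ∃ Q a b, bd g Q = vtx a + vtx b ∧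
      (∀ A a' b', bd g A = vtx a' + vtx b' → ∑ e ∈ Q, w e ≤ ∑ e ∈ A, w e) ∧
      (∀ A a' b', bd g A = vtx a' + vtx b' → ∑ e ∈ A, w e ≤ ∑ e ∈ Q, w e → Q.card ≤ A.card) := by
  classical
  let S : Finset (Finset E) := Finset.univ.filter (fun Q => ∃ a b, bd g Q = vtx a + vtx b)
  obtain ⟨Q₀, hQ₀, h₀⟩ := Finset.exists_min_image S (fun Q => ∑ e ∈ Q, w e)
    ⟨∅, by simpa [S] using ⟨u, u, by simp [bd, add_self_zero]⟩⟩
  obtain ⟨Q, hQ, h⟩ := Finset.exists_min_image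
    (S.filter (fun Q => ∑ e ∈ Q, w e ≤ ∑ e ∈ Q₀, w e)) Finset.card ⟨Q₀, by simp [hQ₀]⟩
  simp only [Finset.mem_filter, S, Finset.mem_univ, true_and] at hQ h h₀
  obtain ⟨⟨a, b, hab⟩, hle⟩ := hQ
  refine ⟨Q, a, b, hab, fun A a' b' hA => hle.trans (h₀ A ⟨a', b', hA⟩), fun A a' b' hA hAQ => ?_⟩
  exact h A ⟨⟨a', b', hA⟩, hAQ.trans hle⟩

/-- The vertex `b` is an end of a globally shortest path Q, and `f` is the last edge of Q. The final
clause says that lowering the absolute weights on the star of `b` does not make a tight closed set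
negative. -/
theorem exists_star [Fintype W] (g : E → W × W) (w : E → ℝ)
    (hcons : ∀ F, bd g F = 0 → 0 ≤ ∑ e ∈ F, w e)
    (hnz : ∀ e, (g e).1 ≠ (g e).2 → w e ≠ 0) (e₀ : E) (he₀ : w e₀ < 0) :
    ∃ b, ∃ f, w f < 0 ∧ f ∈ gcut g {b} ∧ (∀ e ∈ gcut g {b}, w e < 0 → e = f) ∧
      ∀ F, bd g F = 0 → ∑ e ∈ F, w e = 0 →
        ∑ e ∈ F ∩ gcut g {b}, (if w e < 0 then (-1 : ℝ) else 1) ≤ 0 := by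
  obtain ⟨Q, a, b, hQ, hQw, hQc⟩ := exists_shortest_join g w (g e₀).1
  have hQneg : ∑ e ∈ Q, w e < 0 := by
    refine (hQw {e₀} (g e₀).1 (g e₀).2 (by simp [bd])).trans_lt (by simpa using he₀)
  have hab : a ≠ b := by
    rintro rfl
    rw [add_self_zero] at hQ
    exact absurd (hcons Q hQ) (not_le.2 hQneg)
  have hQmin : ∀ A ⊆ Q, bd g A = 0 → A = ∅ := by
    intro A hA h0
    have h1 : bd g (Q \ A) = vtx a + vtx b := by rw [bd_sdiff hA, h0, hQ, add_zero]
    have h2 := Finset.sum_sdiff (f := w) hA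
    have h3 := hQc _ a b h1 (by linarith [hcons A h0])
    rw [Finset.card_sdiff_of_subset hA] at h3
    have h4 := Finset.card_le_card hA
    by_contra hne
    have := Finset.card_pos.2 (Finset.nonempty_iff_ne_empty.2 hne)
    omega
  have hcut_ne : ∀ e ∈ gcut g {b}, w e ≠ 0 := by
    intro e he
    refine hnz e fun h => ?_
    rw [mem_gcut, h] at he
    exact he Iff.rfl
  obtain ⟨f, hf⟩ := Finset.card_eq_one.1 (card_end_eq_one hab hQ hQmin)
  have hfm : f ∈ Q ∧ f ∈ gcut g {b} := by
    rw [← Finset.mem_inter, hf]; simp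
  have huniq : ∀ e ∈ Q, e ∈ gcut g {b} → e = f := by
    intro e h1 h2
    have : e ∈ Q ∩ gcut g {b} := Finset.mem_inter.2 ⟨h1, h2⟩
    rwa [hf, Finset.mem_singleton] at this
  -- Otherwise dropping `f` would give a shorter path; likewise, below, a second negative edge at
  -- `b` could be appended to `Q`.
  have hfneg : w f < 0 := by
    obtain ⟨u, -, hu⟩ := bd_singleton_of_mem hfm.2
    have h1 : bd g (Q \ {f}) = vtx a + vtx u := by
      rw [bd_sdiff (by simpa using hfm.1), hQ, hu]
      calc vtx a + vtx b + (vtx b + vtx u) = vtx a + vtx u + (vtx b + vtx b) := by abel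
        _ = _ := by rw [add_self_zero, add_zero]
    have h2 := hQw _ a u h1
    have h3 := Finset.sum_sdiff (f := w) (Finset.singleton_subset_iff.2 hfm.1)
    rw [Finset.sum_singleton] at h3
    exact lt_of_le_of_ne (by linarith) (hcut_ne f hfm.2)
  have hneg_uniq : ∀ e ∈ gcut g {b}, w e < 0 → e = f := by
    intro e he hw
    by_contra hne
    have heQ : e ∉ Q := fun h => hne (huniq e h he)
    obtain ⟨u, -, hu⟩ := bd_singleton_of_mem he
    have h1 : bd g (insert e Q) = vtx a + vtx u := by
      rw [bd_insert heQ, hQ, hu]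
      calc vtx b + vtx u + (vtx a + vtx b) = vtx a + vtx u + (vtx b + vtx b) := by abel
        _ = _ := by rw [add_self_zero, add_zero]
    have h2 := hQw _ a u h1
    rw [Finset.sum_insert heQ] at h2
    linarith
  refine ⟨b, f, hfneg, hfm.2, hneg_uniq, ?_⟩
  intro F
  induction F using Finset.strongInduction with
  | H F ih =>
  intro hF hw
  -- Both parts of a decomposable tight set are tight, so only circuits remain.
  by_cases hcirc : ∃ A ⊆ F, bd g A = 0 ∧ A ≠ ∅ ∧ A ≠ F
  · obtain ⟨A, hA, hA0, hAe, hAF⟩ := hcirc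
    have hB0 : bd g (F \ A) = 0 := by rw [bd_sdiff hA, hF, hA0, add_zero]
    have hsum := Finset.sum_sdiff (f := w) hA
    have h1 := hcons _ hA0
    have h2 := hcons _ hB0
    have hBss : F \ A ⊂ F :=
      Finset.sdiff_ssubset hA (Finset.nonempty_iff_ne_empty.2 hAe)
    have h3 := ih A (Finset.ssubset_iff_subset_ne.2 ⟨hA, hAF⟩) hA0 (by linarith)
    have h4 := ih (F \ A) hBss hB0 (by linarith)
    have h5 : F ∩ gcut g {b} = ((F \ A) ∩ gcut g {b}) ∪ (A ∩ gcut g {b}) := by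
      rw [← Finset.union_inter_distrib_right, Finset.sdiff_union_of_subset hA]
    rw [h5, Finset.sum_union]
    · linarith
    · exact Finset.disjoint_of_subset_left Finset.inter_subset_left
        (Finset.disjoint_of_subset_right Finset.inter_subset_left Finset.sdiff_disjoint)
  have hmin : ∀ A ⊆ F, bd g A = 0 → A = ∅ ∨ A = F := by
    intro A hA h0
    by_contra hc
    push Not at hc
    exact hcirc ⟨A, hA, h0, Finset.nonempty_iff_ne_empty.1 hc.1, hc.2⟩
  by_cases hfF : f ∈ F
  · have h1 := circuit_star hF hmin hfF hfm.2
    have h2 : F ∩ gcut g {b} = insert f ((F \ {f}) ∩ gcut g {b}) := by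
      ext x
      simp only [Finset.mem_inter, Finset.mem_insert, Finset.mem_sdiff, Finset.mem_singleton]
      constructor
      · rintro ⟨hx, hxb⟩
        by_cases hxf : x = f
        · exact Or.inl hxf
        · exact Or.inr ⟨⟨hx, hxf⟩, hxb⟩
      · rintro (rfl | h)
        · exact ⟨hfF, hfm.2⟩
        · exact ⟨h.1.1, h.2⟩
    obtain ⟨e', he'⟩ := Finset.card_eq_one.1 h1
    rw [h2, Finset.sum_insert (by simp), he', Finset.sum_singleton, if_pos hfneg]
    split_ifs <;> norm_num
  by_cases htouch : ∃ e ∈ F, e ∈ gcut g {b}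
  swap
  · have : F ∩ gcut g {b} = ∅ := by
      ext x
      simp only [Finset.mem_inter, Finset.notMem_empty, iff_false]
      exact fun h => htouch ⟨x, h⟩
    simp [this]
  exfalso
  obtain ⟨e, heF, heb⟩ := htouch
  have hepos : 0 < w e := by
    rcases lt_or_gt_of_ne (hcut_ne e heb) with h | h
    · exact absurd (hneg_uniq e heb h ▸ heF) hfF
    · exact h
  -- A tight circuit through `b` avoiding `f` is impossible. If it is disjoint from `Q`, then `Q`
  -- followed by the circuit minus its positive edge `e` is shorter than `Q`.
  by_cases hdisj : Disjoint Q F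
  · obtain ⟨z, -, hz⟩ := bd_singleton_of_mem heb
    have heF' : {e} ⊆ F := by simpa using heF
    have h1 : bd g (Q ∪ F \ {e}) = vtx a + vtx z := by
      rw [bd_union (Finset.disjoint_of_subset_right Finset.sdiff_subset hdisj), bd_sdiff heF', hF,
        hQ, hz, zero_add]
      calc vtx a + vtx b + (vtx b + vtx z) = vtx a + vtx z + (vtx b + vtx b) := by abel
        _ = _ := by rw [add_self_zero, add_zero]
    have h2 := hQw _ a z h1
    rw [Finset.sum_union (Finset.disjoint_of_subset_right Finset.sdiff_subset hdisj)] at h2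
    have h3 := Finset.sum_sdiff (f := w) heF'
    rw [Finset.sum_singleton] at h3
    linarith
  have hQb : bd g Q b = 1 := by simp [hQ, vtx_ne hab.symm]
  have hQFb : bd g (Q \ F) b = 1 := by
    have h1 : bd g (Q ∩ F) b = 0 := by
      refine bd_zero_of_no_edge fun x hx hxb => ?_
      rw [Finset.mem_inter] at hx
      exact hfF (huniq x hx.1 hxb ▸ hx.2)
    have := congrFun (bd_inter_add (g := g) Q F) b
    simpa [h1, hQb] using this
  -- P is a piece of `Q` from `b`, disjoint from the circuit; it has negative weight since `Q \ P`
  -- is a path with fewer edges.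
  obtain ⟨P, hP, v, hvb, hv1, hPv⟩ := exists_subjoin hQFb
  have hPQ : P ⊆ Q := hP.trans Finset.sdiff_subset
  have hPF : Disjoint P F :=
    Finset.disjoint_of_subset_left hP Finset.sdiff_disjoint
  have hPne : P.Nonempty := by
    rw [Finset.nonempty_iff_ne_empty]
    rintro rfl
    have := congrFun hPv v
    simp [bd, vtx_ne hvb] at this
  have hrest : bd g (Q \ P) = vtx a + vtx v := by
    rw [bd_sdiff hPQ, hQ, hPv]
    calc vtx a + vtx b + (vtx b + vtx v) = vtx a + vtx v + (vtx b + vtx b) := by abel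
      _ = _ := by rw [add_self_zero, add_zero]
  have hPneg : ∑ e ∈ P, w e < 0 := by
    by_contra! h
    have h2 := Finset.sum_sdiff (f := w) hPQ
    have h3 := hQc _ a v hrest (by linarith)
    rw [Finset.card_sdiff_of_subset hPQ] at h3
    have h4 := Finset.card_le_card hPQ
    have := Finset.card_pos.2 hPne
    omega
  by_cases hvF : ∃ e' ∈ F, e' ∈ gcut g {v}
  · obtain ⟨e', he'F, he'v⟩ := hvF
    obtain ⟨A, hA, hAv⟩ := exists_join_in_circuit hF hmin heF heb he'F he'v
    -- Closing P by either half of the circuit gives a closed set. The two weights add up to 2w(P) +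
    -- w(F) = 2w(P) < 0.
    have key : ∀ B ⊆ F, bd g B = vtx b + vtx v → 0 ≤ ∑ e ∈ P, w e + ∑ e ∈ B, w e := by
      intro B hB hBv
      have hd : Disjoint P B := Finset.disjoint_of_subset_right hB hPF
      rw [← Finset.sum_union hd]
      exact hcons _ (by rw [bd_union hd, hPv, hBv, add_self_zero])
    have h1 := key A hA hAv
    have h2 := key (F \ A) Finset.sdiff_subset (by rw [bd_sdiff hA, hF, hAv, zero_add])
    have h3 := Finset.sum_sdiff (f := w) hA
    linarith
  -- If the circuit misses `v`, then `v` is odd in `Q`, so `v = a` and P is all of `Q`, although `Q`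
  -- meets the circuit.
  · have h1 : bd g (Q ∩ F) v = 0 := by
      refine bd_zero_of_no_edge fun x hx hxv => ?_
      exact hvF ⟨x, (Finset.mem_inter.1 hx).2, hxv⟩
    have h2 : bd g Q v = 1 := by
      have := congrFun (bd_inter_add (g := g) Q F) v
      rw [← this, Pi.add_apply, h1, hv1, zero_add]
    have hva : v = a := by
      by_contra hva
      simp [hQ, vtx_ne hva, vtx_ne hvb] at h2
    have h3 := hQmin (Q \ P) Finset.sdiff_subset (by rw [hrest, hva, add_self_zero])
    rw [Finset.not_disjoint_iff] at hdisj
    obtain ⟨x, hxQ, hxF⟩ := hdisj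
    have hxP : x ∉ P := fun h => (Finset.disjoint_left.1 hPF h) hxF
    have : x ∈ Q \ P := Finset.mem_sdiff.2 ⟨hxQ, hxP⟩
    rw [h3] at this
    simp at this

/-! ### The T-join theorem by dual ascent -/

/-- The cost of exchanging along an edge set relative to the edge set `J`. -/
def signed (J : Finset E) (c : E → ℝ) (e : E) : ℝ := if e ∈ J then -c e else c e

theorem sum_symmDiff_eq (J F : Finset E) (c : E → ℝ) :
    ∑ e ∈ J ∆ F, c e = ∑ e ∈ J, c e + ∑ e ∈ F, signed J c e := by
  have h : J ∆ F = (J \ F) ∪ (F \ J) := rfl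
  rw [h, Finset.sum_union disjoint_sdiff_sdiff, ← Finset.sum_inter_add_sum_sdiff J F c,
    ← Finset.sum_inter_add_sum_sdiff F J (signed J c), Finset.inter_comm F J]
  have h1 : ∑ e ∈ J ∩ F, signed J c e = -∑ e ∈ J ∩ F, c e := by
    rw [← Finset.sum_neg_distrib]
    exact Finset.sum_congr rfl fun e he => if_pos (Finset.mem_inter.1 he).1
  have h2 : ∑ e ∈ F \ J, signed J c e = ∑ e ∈ F \ J, c e :=
    Finset.sum_congr rfl fun e he => if_neg (Finset.mem_sdiff.1 he).2
  rw [h1, h2]; ring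

/-- Contracting the edges of cost zero. -/
theorem exists_contraction [Fintype W] (g : E → W × W) (c : E → ℝ) :
    ∃ ρ : W → W, (∀ e, c e = 0 → ρ (g e).1 = ρ (g e).2) ∧
      ∀ F, bd (Prod.map ρ ρ ∘ g) F = 0 → ∃ Z, (∀ e ∈ Z, c e = 0) ∧ bd g (F ∆ Z) = 0 := by
  classical
  let r : W → W → Prop := fun a b => ∃ e, c e = 0 ∧ g e = (a, b)
  let st : Setoid W := Relation.EqvGen.setoid r
  let ρ : W → W := fun v => (Quotient.mk st v).out
  have hρ : ∀ v, Relation.EqvGen r v (ρ v) := fun v =>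
    Relation.EqvGen.symm _ _ (Quotient.exact (s := st) (Quotient.out_eq (Quotient.mk st v)))
  -- The boundaries of zero-cost edge sets: modulo N, a vertex equals its representative, so
  -- contraction changes boundaries only within N.
  let N : AddSubgroup (W → ZMod 2) :=
    { carrier := {x | ∃ Z, (∀ e ∈ Z, c e = 0) ∧ bd g Z = x}
      zero_mem' := ⟨∅, by simp, by simp [bd]⟩
      add_mem' := by
        rintro x y ⟨Z, hZ, rfl⟩ ⟨Y, hY, rfl⟩
        refine ⟨Z ∆ Y, fun e he => ?_, bd_symmDiff _ _⟩
        rcases Finset.mem_symmDiff.1 he with h | h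
        · exact hZ e h.1
        · exact hY e h.1
      neg_mem' := by
        rintro x ⟨Z, hZ, rfl⟩
        exact ⟨Z, hZ, eq_neg_of_add_eq_zero_left (add_self_zero _)⟩ }
  have hN : ∀ a b, Relation.EqvGen r a b → vtx a + vtx b ∈ N := by
    intro a b h
    induction h with
    | rel a b h =>
      obtain ⟨e, he, hg⟩ := h
      exact ⟨{e}, by simpa using he, by simp [bd, hg]⟩
    | refl a => rw [add_self_zero]; exact N.zero_mem
    | symm a b _ ih => rwa [add_comm]
    | trans a b d _ _ h1 h2 =>
      have h3 := N.add_mem h1 h2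
      have h4 : vtx a + vtx b + (vtx b + vtx d) = vtx a + vtx d + (vtx b + vtx b) := by abel
      rwa [h4, add_self_zero, add_zero] at h3
  refine ⟨ρ, fun e he => ?_, fun F hF => ?_⟩
  · have : Quotient.mk st (g e).1 = Quotient.mk st (g e).2 :=
      Quotient.sound (s := st) (Relation.EqvGen.rel _ _ ⟨e, he, rfl⟩)
    simp only [ρ, this]
  · have h1 : bd g F ∈ N := by
      have h2 : bd g F + bd (Prod.map ρ ρ ∘ g) F ∈ N := by
        rw [bd, bd, ← Finset.sum_add_distrib]
        refine N.sum_mem fun e _ => ?_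
        have h3 := N.add_mem (hN _ _ (hρ (g e).1)) (hN _ _ (hρ (g e).2))
        convert h3 using 1
        simp only [Function.comp, Prod.map]
        abel
      rwa [hF, add_zero] at h2
    obtain ⟨Z, hZ, hZF⟩ := h1
    exact ⟨Z, hZ, by rw [bd_symmDiff, hZF, add_self_zero]⟩

/-- One ascent step. After contraction of the zero-cost edges every non-loop has nonzero signed
cost, as `exists_star` requires; U is the preimage of the star's centre, and J has exactly the
negative edges of the star. -/
theorem exists_reduction [Fintype W] (g : E → W × W) (J : Finset E) (c : E → ℝ)
    (hc : ∀ e, 0 ≤ c e) (hJ : ∀ F, bd g F = 0 → 0 ≤ ∑ e ∈ F, signed J c e)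
    (hpos : 0 < ∑ e ∈ J, c e) :
    ∃ U : Finset W, ∃ ε > (0 : ℝ), (J ∩ gcut g U).card = 1 ∧ (∀ e ∈ gcut g U, ε ≤ c e) ∧
      ∀ F, bd g F = 0 →
        0 ≤ ∑ e ∈ F, signed J (fun e => c e - if e ∈ gcut g U then ε else 0) e := by
  classical
  obtain ⟨ρ, hρ, hlift⟩ := exists_contraction g c
  obtain ⟨e₀, he₀, hce₀⟩ := Finset.exists_lt_of_sum_lt
    (s := J) (f := fun _ => (0 : ℝ)) (g := c) (by simpa using hpos)
  have hcut : ∀ b, gcut (Prod.map ρ ρ ∘ g) {b} = gcut g (Finset.univ.filter (fun v => ρ v = b)) := by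
    intro b; ext e; simp [mem_gcut]
  have hbd : ∀ F, bd g F = 0 → bd (Prod.map ρ ρ ∘ g) F = 0 := by
    intro F hF
    funext b
    rw [bd_apply, hcut, ← sum_bd, hF]
    simp
  have hcons : ∀ F, bd (Prod.map ρ ρ ∘ g) F = 0 → 0 ≤ ∑ e ∈ F, signed J c e := by
    intro F hF
    obtain ⟨Z, hZ, hFZ⟩ := hlift F hF
    have h1 := hJ _ hFZ
    rw [sum_symmDiff_eq] at h1
    have h2 : ∑ e ∈ Z, signed F (signed J c) e = 0 :=
      Finset.sum_eq_zero fun e he => by simp [signed, hZ e he]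
    linarith
  have hnz : ∀ e, ρ (g e).1 ≠ ρ (g e).2 → 0 < c e := fun e he =>
    lt_of_le_of_ne (hc e) fun h => he (hρ e h.symm)
  obtain ⟨b, f, hf, hfb, huniq, hk⟩ := exists_star (Prod.map ρ ρ ∘ g) (signed J c) hcons
    (by
      intro e he
      have := hnz e he
      unfold signed
      split_ifs
      · linarith
      · exact this.ne')
    e₀ (by simpa [signed, he₀] using hce₀)
  rw [hcut] at hfb huniq
  simp only [hcut] at hk
  set U := Finset.univ.filter (fun v => ρ v = b) with hU
  have hcpos : ∀ e ∈ gcut g U, 0 < c e := by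
    intro e he
    refine hnz e fun h => ?_
    rw [mem_gcut] at he
    simp [hU, h] at he
  have hsign : ∀ e ∈ gcut g U, (signed J c e < 0 ↔ e ∈ J) := by
    intro e he
    have := hcpos e he
    unfold signed
    split_ifs with h
    · simp [h, this]
    · simp [h, this.le]
  let k : Finset E → ℝ := fun F => ∑ e ∈ F ∩ gcut g U, (if e ∈ J then (-1 : ℝ) else 1)
  have hk' : ∀ F, bd g F = 0 → ∑ e ∈ F, signed J c e = 0 → k F ≤ 0 := by
    intro F hF h0
    refine le_of_eq_of_le (Finset.sum_congr rfl fun e he => ?_) (hk F (hbd F hF) h0)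
    simp only [hsign e (Finset.mem_inter.1 he).2]
  have ev1 : ∀ᶠ ε in nhdsWithin (0 : ℝ) (Set.Ioi 0), ∀ e ∈ gcut g U, ε ≤ c e := by
    rw [Filter.eventually_all_finset]
    intro e he
    exact nhdsWithin_le_nhds ((eventually_lt_nhds (hcpos e he)).mono fun _ h => h.le)
  -- Tight closed sets have `k F ≤ 0`, so any positive ε is safe; the finitely many others have
  -- positive slack.
  have ev2 : ∀ᶠ ε in nhdsWithin (0 : ℝ) (Set.Ioi 0), ∀ F, bd g F = 0 →
      ε * k F ≤ ∑ e ∈ F, signed J c e := by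
    rw [Filter.eventually_all]
    intro F
    by_cases hF : bd g F = 0
    · rcases (hJ F hF).eq_or_lt with h | h
      · filter_upwards [self_mem_nhdsWithin] with ε hε _
        rw [← h]
        exact mul_nonpos_of_nonneg_of_nonpos (le_of_lt hε) (hk' F hF h.symm)
      · have ht : Filter.Tendsto (fun ε : ℝ => ε * k F) (nhds 0) (nhds 0) := by
          have : Continuous (fun ε : ℝ => ε * k F) := by fun_prop
          simpa using this.tendsto 0
        have := nhdsWithin_le_nhds (s := Set.Ioi (0 : ℝ)) (ht.eventually_lt_const h)
        filter_upwards [this] with ε hε _ using hε.le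
    · exact Filter.Eventually.of_forall fun _ h => absurd h hF
  obtain ⟨ε, ⟨hε1, hε2⟩, hε⟩ := ((ev1.and ev2).and self_mem_nhdsWithin).exists
  refine ⟨U, ε, hε, ?_, hε1, fun F hF => ?_⟩
  · rw [Finset.card_eq_one]
    refine ⟨f, ?_⟩
    ext e
    simp only [Finset.mem_inter, Finset.mem_singleton]
    constructor
    · rintro ⟨h1, h2⟩
      exact huniq e h2 ((hsign e h2).2 h1)
    · rintro rfl
      exact ⟨(hsign e hfb).1 hf, hfb⟩
  · have h1 : ∑ e ∈ F, signed J (fun e => c e - if e ∈ gcut g U then ε else 0) e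
        = ∑ e ∈ F, signed J c e - ε * k F := by
      simp only [k]
      rw [← Finset.filter_mem_eq_inter, Finset.sum_filter, Finset.mul_sum,
        ← Finset.sum_sub_distrib]
      refine Finset.sum_congr rfl fun e _ => ?_
      by_cases h1 : e ∈ J <;> by_cases h2 : e ∈ gcut g U <;> simp [signed, h1, h2]
      ring
    rw [h1]
    linarith [hε2 F hF]

/-- Edmonds and Johnson: a minimum cost `T`-join costs at most as much as any nonnegative vector
that has value at least one on every `T`-cut. -/
theorem sum_le_of_conservative [Fintype W] (g : E → W × W) (J : Finset E) (c y : E → ℝ)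
    (hc : ∀ e, 0 ≤ c e) (hJ : ∀ F, bd g F = 0 → 0 ≤ ∑ e ∈ F, signed J c e)
    (hy : ∀ e, 0 ≤ y e)
    (hcut : ∀ U : Finset W, ∑ v ∈ U, bd g J v = 1 → 1 ≤ ∑ e ∈ gcut g U, y e) :
    ∑ e ∈ J, c e ≤ ∑ e, c e * y e := by
  classical
  -- Possible residual costs d: the part c - d already removed costs J no more than it costs `y`.
  -- Compactness replaces termination of the ascent.
  let K : Set (E → ℝ) := Set.Icc 0 c ∩ ({d | ∀ F, bd g F = 0 → 0 ≤ ∑ e ∈ F, signed J d e} ∩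
    {d | ∑ e ∈ J, c e - ∑ e ∈ J, d e ≤ ∑ e, c e * y e - ∑ e, d e * y e})
  have hKc : IsCompact K := by
    refine isCompact_Icc.inter_right (IsClosed.inter ?_ ?_)
    · simp only [Set.ofPred_forall]
      refine isClosed_iInter fun F => isClosed_iInter fun _ => ?_
      refine isClosed_le continuous_const (continuous_finsetSum _ fun e _ => ?_)
      unfold signed
      split_ifs <;> fun_prop
    · exact isClosed_le (by fun_prop) (by fun_prop)
  obtain ⟨d, ⟨⟨hd0, hdc⟩, hdJ, hdy⟩, hdmin⟩ := hKc.exists_isMinOn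
    ⟨c, ⟨hc, le_rfl⟩, hJ, by simp⟩
    (f := fun d => ∑ e ∈ J, d e) (by fun_prop)
  have hdy0 : 0 ≤ ∑ e, d e * y e := Finset.sum_nonneg fun e _ => mul_nonneg (hd0 e) (hy e)
  rcases (Finset.sum_nonneg fun e (_ : e ∈ J) => hd0 e).eq_or_lt with h0 | hpos
  · simp only [Set.mem_ofPred_eq] at hdy h0
    linarith
  exfalso
  -- The step lowers the cost of J by exactly ε and that of `y` by at least ε, since a cut with one
  -- edge of J is a T-cut.
  obtain ⟨U, ε, hε, hU1, hUc, hUJ⟩ := exists_reduction g J d hd0 hdJ hpos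
  have hyU : 1 ≤ ∑ e ∈ gcut g U, y e := hcut U (by rw [sum_bd, hU1]; simp)
  have hsumJ : ∑ e ∈ J, (d e - if e ∈ gcut g U then ε else 0) = ∑ e ∈ J, d e - ε := by
    rw [Finset.sum_sub_distrib, ← Finset.sum_filter, Finset.filter_mem_eq_inter,
      Finset.sum_const, hU1, one_smul]
  have hsumy : ∑ e, (d e - if e ∈ gcut g U then ε else 0) * y e
      = ∑ e, d e * y e - ε * ∑ e ∈ gcut g U, y e := by
    simp only [sub_mul, Finset.sum_sub_distrib, ite_mul, zero_mul]
    rw [← Finset.sum_filter, Finset.mul_sum]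
    simp
  have hmem : (fun e => d e - if e ∈ gcut g U then ε else 0) ∈ K := by
    refine ⟨⟨fun e => ?_, fun e => ?_⟩, hUJ, ?_⟩
    · show 0 ≤ d e - if e ∈ gcut g U then ε else 0
      split_ifs with h
      · linarith [hUc e h]
      · simpa using hd0 e
    · show d e - (if e ∈ gcut g U then ε else 0) ≤ c e
      have := hdc e
      split_ifs <;> linarith
    · simp only [Set.mem_ofPred_eq] at hdy ⊢
      rw [hsumJ, hsumy]
      nlinarith
  have := hdmin hmem
  simp only [Set.mem_ofPred_eq] at this
  rw [hsumJ] at this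
  linarith

theorem exists_join_le [Fintype W] (g : E → W × W) (J₀ : Finset E) (c y : E → ℝ)
    (hc : ∀ e, 0 ≤ c e) (hy : ∀ e, 0 ≤ y e)
    (hcut : ∀ U : Finset W, ∑ v ∈ U, bd g J₀ v = 1 → 1 ≤ ∑ e ∈ gcut g U, y e) :
    ∃ J, bd g J = bd g J₀ ∧ ∑ e ∈ J, c e ≤ ∑ e, c e * y e := by
  classical
  obtain ⟨J, hJ, hmin⟩ := Finset.exists_min_image
    (Finset.univ.filter (fun J => bd g J = bd g J₀)) (fun J => ∑ e ∈ J, c e) ⟨J₀, by simp⟩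
  simp only [Finset.mem_filter, Finset.mem_univ, true_and] at hJ hmin
  refine ⟨J, hJ, sum_le_of_conservative g J c y hc (fun F hF => ?_) hy (by rwa [hJ])⟩
  have := hmin (J ∆ F) (by rw [bd_symmDiff, hF, add_zero, hJ])
  rw [sum_symmDiff_eq] at this
  linarith

end TJoin

/-! ### Cuts, spanning trees and wrong-parity joins -/

namespace STPathInstance

open TJoin

variable {V : Type*} [Fintype V] [DecidableEq V]

/-- A choice of the two ends of an unordered pair. -/
noncomputable def ends (e : Sym2 V) : V × V := Quot.out e

theorem mk_ends (e : Sym2 V) : s((ends e).1, (ends e).2) = e := Quot.out_eq e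

theorem gcut_ends (U : Finset V) : gcut ends U = cut U := by
  ext e
  simp only [mem_gcut, cut, Finset.mem_filter, Finset.mem_univ, true_and]
  constructor
  · intro h
    by_cases h1 : (ends e).1 ∈ U
    · exact ⟨_, h1, _, by tauto, (mk_ends e).symm⟩
    · exact ⟨(ends e).2, by tauto, _, h1, by rw [Sym2.eq_swap, mk_ends]⟩
  · rintro ⟨v, hv, w, hw, h⟩
    rw [← mk_ends e, Sym2.eq_iff] at h
    rcases h with ⟨h1, h2⟩ | ⟨h1, h2⟩ <;> simp [h1, h2, hv, hw]

theorem bd_ends_mk (a b : V) : bd ends {s(a, b)} = vtx a + vtx b := by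
  have h := mk_ends s(a, b)
  rw [Sym2.eq_iff] at h
  rcases h with ⟨h1, h2⟩ | ⟨h1, h2⟩ <;> simp [bd, h1, h2, add_comm]

theorem bd_ends_apply (F : Finset (Sym2 V)) (v : V) :
    bd ends F v = (degreeIn F v : ZMod 2) := by
  rw [bd_apply, gcut_ends, degreeIn, Finset.inter_comm]

theorem mem_cut_mk {U : Finset V} {a b : V} : s(a, b) ∈ cut U ↔ ¬(a ∈ U ↔ b ∈ U) := by
  simp only [cut, Finset.mem_filter, Finset.mem_univ, true_and, Sym2.eq_iff]
  constructor
  · rintro ⟨v, hv, w, hw, ⟨rfl, rfl⟩ | ⟨rfl, rfl⟩⟩ <;> simp [hv, hw]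
  · intro h
    by_cases h1 : a ∈ U
    · exact ⟨a, h1, b, by tauto, by simp⟩
    · exact ⟨b, by tauto, a, h1, by simp⟩

theorem cut_subset_edges (U : Finset V) : cut U ⊆ edges V := by
  intro e
  induction e with
  | h a b =>
    rw [mem_cut_mk]
    simp only [edges, Finset.mem_filter, Finset.mem_univ, true_and, Sym2.mk_isDiag_iff]
    rintro h rfl
    exact h Iff.rfl

theorem mem_cut_symmDiff {U U' : Finset V} {e : Sym2 V} :
    e ∈ cut (U ∆ U') ↔ ¬(e ∈ cut U ↔ e ∈ cut U') := by
  induction e with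
  | h a b => simp only [mem_cut_mk, Finset.mem_symmDiff]; tauto

theorem cut_compl (U : Finset V) : cut Uᶜ = cut U := by
  ext e
  induction e with
  | h a b => simp only [mem_cut_mk, Finset.mem_compl]; tauto

theorem mem_spanningTrees {S : Finset (Sym2 V)} : S ∈ spanningTrees V ↔
    S ⊆ edges V ∧ (SimpleGraph.fromEdgeSet (S : Set (Sym2 V))).IsTree := by
  simp [spanningTrees]

/-- A spanning tree meets every cut. -/
theorem eq_empty_or_univ_of_inter_cut {S : Finset (Sym2 V)} (hS : S ∈ spanningTrees V)
    {U : Finset V} (h : S ∩ cut U = ∅) : U = ∅ ∨ U = Finset.univ := by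
  have hconn := (mem_spanningTrees.1 hS).2.1
  have hwalk : ∀ a b, (SimpleGraph.fromEdgeSet (S : Set (Sym2 V))).Walk a b → a ∈ U → b ∈ U := by
    intro a b P
    induction P with
    | nil => exact id
    | cons hadj P ih =>
      rename_i u v w
      intro hu
      refine ih ?_
      by_contra hv
      have h1 : s(u, v) ∈ S ∩ cut U := by
        rw [Finset.mem_inter, mem_cut_mk]
        rw [SimpleGraph.fromEdgeSet_adj] at hadj
        exact ⟨by exact_mod_cast hadj.1, by simp [hu, hv]⟩
      rw [h] at h1
      simp at h1
  rcases U.eq_empty_or_nonempty with h0 | ⟨a, ha⟩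
  · exact Or.inl h0
  · right
    refine Finset.eq_univ_iff_forall.2 fun b => ?_
    obtain ⟨P⟩ := hconn.preconnected a b
    exact hwalk a b P ha

/-- The tree misses the cut of `U ∆ U'`, so by connectivity U' is U or its complement. -/
theorem cut_eq_of_inter_eq {S : Finset (Sym2 V)} (hS : S ∈ spanningTrees V)
    {U U' : Finset V} (h : S ∩ cut U = S ∩ cut U') : cut U = cut U' := by
  have h1 : S ∩ cut (U ∆ U') = ∅ := by
    ext e
    have := congrArg (e ∈ ·) h
    simp only [Finset.mem_inter, mem_cut_symmDiff, Finset.notMem_empty, eq_iff_iff] at this ⊢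
    tauto
  rcases eq_empty_or_univ_of_inter_cut hS h1 with h2 | h2
  · rw [← Finset.bot_eq_empty, symmDiff_eq_bot] at h2
    rw [h2]
  · have : U' = Uᶜ := by
      ext v
      have := Finset.eq_univ_iff_forall.1 h2 v
      rw [Finset.mem_symmDiff] at this
      rw [Finset.mem_compl]
      tauto
    rw [this, cut_compl]

theorem bd_trail {G : SimpleGraph V} {u v : V} (P : G.Walk u v) (hP : P.IsTrail) :
    bd ends P.edges.toFinset = vtx u + vtx v := by
  induction P with
  | nil => simp [bd, add_self_zero]
  | cons hadj P ih =>
    rename_i u v w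
    rw [SimpleGraph.Walk.isTrail_cons] at hP
    rw [SimpleGraph.Walk.edges_cons, List.toFinset_cons, bd_insert (by simpa using hP.2),
      ih hP.1, bd_ends_mk]
    calc vtx u + vtx v + (vtx v + vtx w) = vtx u + vtx w + (vtx v + vtx v) := by abel
      _ = _ := by rw [add_self_zero, add_zero]

theorem pathEdges_subset (I : STPathInstance V) (S : Finset (Sym2 V)) : I.pathEdges S ⊆ S := by
  classical
  exact Finset.filter_subset _ _

theorem bd_pathEdges (I : STPathInstance V) {S : Finset (Sym2 V)} (hS : S ∈ spanningTrees V) :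
    bd ends (I.pathEdges S) = vtx I.s + vtx I.t := by
  obtain ⟨P, hP, huniq⟩ := (mem_spanningTrees.1 hS).2.existsUnique_path I.s I.t
  have h : I.pathEdges S = P.edges.toFinset := by
    ext e
    simp only [pathEdges, Finset.mem_filter, List.mem_toFinset]
    constructor
    · rintro ⟨-, Q, hQ, he⟩
      rwa [huniq Q hQ] at he
    · intro he
      refine ⟨?_, P, hP, he⟩
      have := P.edges_subset_edgeSet he
      rw [SimpleGraph.edgeSet_fromEdgeSet] at this
      exact_mod_cast this.1
  rw [h, bd_trail P hP.isTrail]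

theorem bd_sdiff_pathEdges (I : STPathInstance V) {S : Finset (Sym2 V)}
    (hS : S ∈ spanningTrees V) :
    bd ends (S \ I.pathEdges S) = bd ends S + (vtx I.s + vtx I.t) := by
  rw [bd_sdiff (I.pathEdges_subset S), I.bd_pathEdges hS]

theorem isTJoin_of_bd (I : STPathInstance V) {S J : Finset (Sym2 V)} (hJ : J ⊆ edges V)
    (h : bd ends J = bd ends S + (vtx I.s + vtx I.t)) : IsTJoin (I.wrongParity S) J := by
  have hst := I.s_ne_t
  have key : ∀ v, v ∈ I.wrongParity S ↔ bd ends J v = 1 := by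
    intro v
    have h01 := zmod_cases (bd ends S v)
    have h11 : (1 : ZMod 2) + 1 = 0 := by decide
    simp only [wrongParity, Finset.mem_filter, Finset.mem_univ, true_and,
      ← ZMod.natCast_eq_one_iff_odd, ← ZMod.natCast_eq_zero_iff_even, ← bd_ends_apply, h,
      Pi.add_apply]
    by_cases h1 : v = I.s
    · subst h1
      rcases h01 with h0 | h0 <;> simp [h0, vtx_ne hst, h11]
    · by_cases h2 : v = I.t
      · subst h2
        rcases h01 with h0 | h0 <;> simp [h0, vtx_ne hst.symm, h11]
      · simp [h1, h2, vtx_ne h1, vtx_ne h2]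
  refine ⟨hJ, fun v hv => ?_, fun v hv => ?_⟩
  · rw [← ZMod.natCast_eq_one_iff_odd, ← bd_ends_apply]
    exact (key v).1 hv
  · rw [← ZMod.natCast_eq_zero_iff_even, ← bd_ends_apply]
    rcases zmod_cases (bd ends J v) with h0 | h1
    · exact h0
    · exact absurd ((key v).2 h1) hv

theorem edgeCost_nonneg (I : STPathInstance V) (e : Sym2 V) : 0 ≤ I.edgeCost e := by
  induction e with
  | h a b => exact I.dist_nonneg a b

theorem setCost_eq (I : STPathInstance V) {F : Finset (Sym2 V)} (hF : F ⊆ edges V) :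
    I.setCost F = ∑ e ∈ F, I.edgeCost e := by
  simp only [setCost, cost, incidence, mul_ite, mul_one, mul_zero]
  rw [← Finset.sum_filter, Finset.filter_mem_eq_inter, Finset.inter_eq_right.2 hF]

/-- A vector satisfying all `T_S`-cut constraints dominates some `T_S`-join in cost. -/
theorem exists_tJoin_le (I : STPathInstance V) {S : Finset (Sym2 V)} (hS : S ∈ spanningTrees V)
    (y : Sym2 V → ℝ) (hy : ∀ e ∈ edges V, 0 ≤ y e)
    (hcut : ∀ U : Finset V, U.Nonempty → U ⊂ Finset.univ →
      Odd ((S \ I.pathEdges S) ∩ cut U).card → 1 ≤ vecSum y (cut U)) :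
    ∃ J ∈ tJoins (I.wrongParity S), I.setCost J ≤ I.cost y := by
  classical
  -- `Sym2 V` contains the diagonal, where `y` is unconstrained; it is set to 0 there, and diagonal
  -- elements of J are discarded afterwards.
  obtain ⟨J, hJ, hle⟩ := exists_join_le ends (S \ I.pathEdges S) I.edgeCost
    (fun e => if e ∈ edges V then y e else 0) I.edgeCost_nonneg
    (fun e => by
      show 0 ≤ if e ∈ edges V then y e else 0
      split_ifs with h
      · exact hy e h
      · exact le_rfl)
    (fun U hU => by
      rw [sum_bd, gcut_ends, ZMod.natCast_eq_one_iff_odd] at hU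
      have h1 : 1 ≤ vecSum y (cut U) := by
        refine hcut U ?_ ?_ hU
        · rw [Finset.nonempty_iff_ne_empty]
          rintro rfl
          simp [cut] at hU
        · rw [Finset.ssubset_univ_iff]
          rintro rfl
          simp [cut] at hU
      rw [gcut_ends]
      refine h1.trans_eq (Finset.sum_congr rfl fun e he => ?_)
      rw [if_pos (cut_subset_edges U he)])
  have hdiag : bd ends (J \ edges V) = 0 := by
    refine Finset.sum_eq_zero fun e he => ?_
    have h1 : e.IsDiag := by simpa [edges] using (Finset.mem_sdiff.1 he).2
    have h2 : (ends e).1 = (ends e).2 := by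
      rwa [← mk_ends e, Sym2.mk_isDiag_iff] at h1
    rw [h2, add_self_zero]
  have hJ' : bd ends (J ∩ edges V) = bd ends J := by
    rw [← bd_inter_add J (edges V), hdiag, add_zero]
  refine ⟨J ∩ edges V, ?_, ?_⟩
  · simp only [tJoins, Finset.mem_filter, Finset.mem_powerset]
    exact ⟨Finset.inter_subset_right, I.isTJoin_of_bd Finset.inter_subset_right
      (by rw [hJ', hJ, I.bd_sdiff_pathEdges hS])⟩
  · rw [I.setCost_eq Finset.inter_subset_right]
    refine (Finset.sum_le_sum_of_subset_of_nonneg Finset.inter_subset_left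
      fun e _ _ => I.edgeCost_nonneg e).trans (hle.trans_eq ?_)
    simp only [mul_ite, mul_zero, cost]
    rw [← Finset.sum_filter, Finset.filter_mem_eq_inter, Finset.univ_inter]

/-- The path crosses a cut separating s from t an odd number of times, and S∖I_S adds another odd
number. -/
theorem even_inter_cut (I : STPathInstance V) {S : Finset (Sym2 V)} (hS : S ∈ spanningTrees V)
    {U : Finset V} (hU : Odd (U ∩ {I.s, I.t}).card)
    (hJ : Odd ((S \ I.pathEdges S) ∩ cut U).card) : Even (S ∩ cut U).card := by
  rw [← ZMod.natCast_eq_zero_iff_even, ← gcut_ends, ← sum_bd]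
  rw [← ZMod.natCast_eq_one_iff_odd, ← gcut_ends, ← sum_bd, I.bd_sdiff_pathEdges hS] at hJ
  have h1 : ∑ v ∈ U, (vtx I.s + vtx I.t) v = 1 := by
    rw [← ZMod.natCast_eq_one_iff_odd] at hU
    rw [← hU, ← Finset.filter_mem_eq_inter, Finset.card_filter, Nat.cast_sum]
    refine Finset.sum_congr rfl fun v _ => ?_
    have hst := I.s_ne_t
    by_cases hs : v = I.s
    · subst hs; simp [vtx_ne hst]
    · by_cases ht : v = I.t
      · subst ht; simp [vtx_ne hst.symm]
      · simp [hs, ht, vtx_ne hs, vtx_ne ht]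
  simp only [Pi.add_apply] at hJ h1
  rw [Finset.sum_add_distrib, h1] at hJ
  simpa using hJ

end STPathInstance

/-! ### The parity correction vector -/

namespace STPathInstance

open TJoin

variable {V : Type*} [Fintype V] [DecidableEq V]

/-- The parity correction vector of the tree `S`, where `R C` is the missing amount on the narrow
cut `C` and is provided by the edge `m C`. -/
noncomputable def correction (I : STPathInstance V) (x : Sym2 V → ℝ) (β : ℝ)
    (S : Finset (Sym2 V)) (γ : Sym2 V → ℝ) (N : Finset (Finset (Sym2 V)))
    (R : Finset (Sym2 V) → ℝ) (m : Finset (Sym2 V) → Sym2 V) (e : Sym2 V) : ℝ :=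
  β * x e + (1 - 2 * β) * (incidence (S \ I.pathEdges S) e
    + (if e ∈ I.pathEdges S then γ e else 0) + ∑ C ∈ N, R C * incidence {m C} e)

theorem sum_mul_incidence (f : Sym2 V → ℝ) (A F : Finset (Sym2 V)) :
    ∑ e ∈ A, f e * incidence F e = ∑ e ∈ A ∩ F, f e := by
  simp only [incidence, mul_ite, mul_one, mul_zero]
  rw [← Finset.sum_filter, Finset.filter_mem_eq_inter]

section correction

variable (I : STPathInstance V) {x : Sym2 V → ℝ} {β : ℝ} {S : Finset (Sym2 V)}
  {γ : Sym2 V → ℝ} {N : Finset (Finset (Sym2 V))} {R : Finset (Sym2 V) → ℝ}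
  {m : Finset (Sym2 V) → Sym2 V}

theorem sum_mul_correction (f : Sym2 V → ℝ) (A : Finset (Sym2 V)) :
    ∑ e ∈ A, f e * I.correction x β S γ N R m e = β * ∑ e ∈ A, f e * x e
      + (1 - 2 * β) * (∑ e ∈ A ∩ (S \ I.pathEdges S), f e
        + ∑ e ∈ A ∩ I.pathEdges S, f e * γ e
        + ∑ C ∈ N, R C * ∑ e ∈ A ∩ {m C}, f e) := by
  have h1 : ∑ C ∈ N, R C * ∑ e ∈ A ∩ {m C}, f e
      = ∑ e ∈ A, f e * ∑ C ∈ N, R C * incidence {m C} e := by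
    simp only [← sum_mul_incidence, Finset.mul_sum]
    rw [Finset.sum_comm]
    exact Finset.sum_congr rfl fun e _ => Finset.sum_congr rfl fun C _ => by ring
  have h2 : ∑ e ∈ A ∩ I.pathEdges S, f e * γ e
      = ∑ e ∈ A, f e * (if e ∈ I.pathEdges S then γ e else 0) := by
    rw [← Finset.filter_mem_eq_inter, Finset.sum_filter]
    exact Finset.sum_congr rfl fun e _ => by split_ifs <;> simp
  rw [h1, h2, ← sum_mul_incidence, ← Finset.sum_add_distrib, ← Finset.sum_add_distrib,
    Finset.mul_sum, Finset.mul_sum, ← Finset.sum_add_distrib]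
  exact Finset.sum_congr rfl fun e _ => by rw [correction]; ring

theorem correction_nonneg (hβ₀ : 0 ≤ β) (hβ : β < 1 / 2) (hx : ∀ e ∈ edges V, 0 ≤ x e)
    (hγ : ∀ e ∈ I.pathEdges S, 0 ≤ γ e) (hR : ∀ C ∈ N, 0 ≤ R C) {e : Sym2 V}
    (he : e ∈ edges V) : 0 ≤ I.correction x β S γ N R m e := by
  have hinc : ∀ F : Finset (Sym2 V), 0 ≤ incidence F e := by
    intro F; unfold incidence; split_ifs <;> norm_num
  refine add_nonneg (mul_nonneg hβ₀ (hx e he)) (mul_nonneg (by linarith) ?_)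
  refine add_nonneg (add_nonneg (hinc _) ?_)
    (Finset.sum_nonneg fun C hC => mul_nonneg (hR C hC) (hinc _))
  split_ifs with h
  · exact hγ e h
  · exact le_rfl

theorem vecSum_correction (A : Finset (Sym2 V)) :
    vecSum (I.correction x β S γ N R m) A = β * vecSum x A
      + (1 - 2 * β) * ((A ∩ (S \ I.pathEdges S)).card + ∑ e ∈ A ∩ I.pathEdges S, γ e
        + ∑ C ∈ N, R C * (A ∩ {m C}).card) := by
  have := sum_mul_correction I (x := x) (β := β) (S := S) (γ := γ) (N := N) (R := R) (m := m)
    (fun _ => 1) A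
  simpa [vecSum] using this

theorem cost_correction (hS : S ⊆ edges V) (hm : ∀ C ∈ N, m C ∈ edges V) :
    I.cost (I.correction x β S γ N R m) = β * I.cost x
      + (1 - 2 * β) * (I.setCost S - ∑ e ∈ I.pathEdges S, (1 - γ e) * I.edgeCost e
        + ∑ C ∈ N, R C * I.edgeCost (m C)) := by
  have hP := I.pathEdges_subset S
  have h1 : ∑ C ∈ N, R C * ∑ e ∈ edges V ∩ {m C}, I.edgeCost e
      = ∑ C ∈ N, R C * I.edgeCost (m C) := by
    refine Finset.sum_congr rfl fun C hC => ?_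
    rw [Finset.inter_singleton_of_mem (hm C hC), Finset.sum_singleton]
  rw [cost, sum_mul_correction, h1, I.setCost_eq hS,
    Finset.inter_eq_right.2 (Finset.sdiff_subset.trans hS), Finset.inter_eq_right.2 (hP.trans hS),
    ← Finset.sum_sdiff hP]
  simp only [sub_mul, one_mul, Finset.sum_sub_distrib, mul_comm (γ _)]
  rw [cost]
  ring

/-- The correction vector satisfies the `T_S`-cut constraints. -/
theorem one_le_vecSum_correction (hx : I.Feasible x) (hS : S ∈ spanningTrees V)
    (hβ₀ : 0 ≤ β) (hβ : β < 1 / 2) {ε : Finset (Sym2 V) → Sym2 V}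
    (hε : ∀ C ∈ narrowCuts x, ε C ∈ I.pathEdges S ∩ C)
    (hγ : ∀ e ∈ I.pathEdges S, 0 ≤ γ e) (hR : ∀ C ∈ narrowCuts x, 0 ≤ R C)
    (hRγ : ∀ C ∈ narrowCuts x, Even (S ∩ C).card →
      β * (2 - vecSum x C) / (1 - 2 * β) ≤ γ (ε C) + R C)
    (hm : ∀ C ∈ narrowCuts x, m C ∈ C) {U : Finset V} (hU : U.Nonempty) (hU' : U ⊂ Finset.univ)
    (hodd : Odd ((S \ I.pathEdges S) ∩ cut U).card) :
    1 ≤ vecSum (I.correction x β S γ (narrowCuts x) R m) (cut U) := by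
  have hB : 0 < 1 - 2 * β := by linarith
  rw [vecSum_correction]
  have h1 : (1 : ℝ) ≤ (cut U ∩ (S \ I.pathEdges S)).card := by
    rw [Finset.inter_comm]
    exact_mod_cast hodd.pos
  have hγ' : ∀ e ∈ cut U ∩ I.pathEdges S, 0 ≤ γ e := fun e he => hγ e (Finset.mem_inter.1 he).2
  have hR' : ∀ C ∈ narrowCuts x, 0 ≤ R C * ((cut U ∩ {m C}).card : ℝ) :=
    fun C hC => mul_nonneg (hR C hC) (Nat.cast_nonneg _)
  have h2 := Finset.sum_nonneg hγ'
  have h3 := Finset.sum_nonneg hR'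
  -- On a cut that is not narrow, 2β from `x` and 1-2β from S∖I_S suffice.
  by_cases hnar : vecSum x (cut U) < 2
  swap
  · have := mul_le_mul_of_nonneg_left (not_lt.1 hnar) hβ₀
    nlinarith
  have hC : cut U ∈ narrowCuts x := by
    refine Finset.mem_image_of_mem _ ?_
    simp [hU, hU', hnar]
  have hst : Odd (U ∩ {I.s, I.t}).card := by
    rw [← Nat.not_even_iff_odd]
    intro h
    linarith [hx.cut_even U hU hU' h]
  have heven := I.even_inter_cut hS hst hodd
  have h4 := hRγ _ hC heven
  have h5 : γ (ε (cut U)) ≤ ∑ e ∈ cut U ∩ I.pathEdges S, γ e :=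
    Finset.single_le_sum hγ' (by rw [Finset.inter_comm]; exact hε _ hC)
  have h6 : R (cut U) ≤ ∑ C ∈ narrowCuts x, R C * ((cut U ∩ {m C}).card : ℝ) := by
    have := Finset.single_le_sum hR' hC
    rwa [Finset.inter_singleton_of_mem (hm _ hC), Finset.card_singleton, Nat.cast_one,
      mul_one] at this
  rw [div_le_iff₀ hB] at h4
  nlinarith

end correction

/-! ### Savings, deficits and averaging -/

/-- Summed over the narrow cuts that a tree meets in a single edge, the costs released by the
chosen edges amount to at most what the path releases. -/
theorem sum_released_le (I : STPathInstance V) {x : Sym2 V → ℝ} {S : Finset (Sym2 V)}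
    (hS : S ∈ spanningTrees V) {ε : Finset (Sym2 V) → Sym2 V}
    (hε : ∀ C ∈ narrowCuts x, ε C ∈ I.pathEdges S ∩ C) {γ : Sym2 V → ℝ}
    (hγ : ∀ e ∈ I.pathEdges S, γ e ≤ 1) :
    ∑ C ∈ narrowCuts x, (if (S ∩ C).card = 1 then 1 - γ (ε C) else 0) * I.edgeCost (ε C)
      ≤ ∑ e ∈ I.pathEdges S, (1 - γ e) * I.edgeCost e := by
  classical
  have hmem : ∀ C ∈ narrowCuts x, ε C ∈ S ∩ C := fun C hC => by
    have := Finset.mem_inter.1 (hε C hC)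
    exact Finset.mem_inter.2 ⟨I.pathEdges_subset S this.1, this.2⟩
  -- A cut meeting the tree in one edge is the fundamental cut of that edge, so no path edge is
  -- charged twice.
  have hinj : Set.InjOn ε ((narrowCuts x).filter (fun C => (S ∩ C).card = 1)) := by
    intro C hC C' hC' h
    simp only [Finset.coe_filter, Set.mem_ofPred_eq] at hC hC'
    have hsing : ∀ C ∈ narrowCuts x, (S ∩ C).card = 1 → S ∩ C = {ε C} := by
      intro C hC h1
      obtain ⟨e, he⟩ := Finset.card_eq_one.1 h1
      have := hmem C hC
      rw [he, Finset.mem_singleton] at this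
      rw [he, this]
    have h2 : S ∩ C = S ∩ C' := by
      rw [hsing C hC.1 hC.2, hsing C' hC'.1 hC'.2, h]
    obtain ⟨U, -, rfl⟩ := Finset.mem_image.1 hC.1
    obtain ⟨U', -, rfl⟩ := Finset.mem_image.1 hC'.1
    exact cut_eq_of_inter_eq hS h2
  simp only [ite_mul, zero_mul]
  rw [← Finset.sum_filter,
    ← Finset.sum_image (f := fun e => (1 - γ e) * I.edgeCost e) hinj]
  refine Finset.sum_le_sum_of_subset_of_nonneg ?_ fun e he _ =>
    mul_nonneg (by linarith [hγ e he]) (I.edgeCost_nonneg e)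
  intro e he
  obtain ⟨C, hC, rfl⟩ := Finset.mem_image.1 he
  exact (Finset.mem_inter.1 (hε C (Finset.mem_filter.1 hC).1)).1

theorem cost_eq_sum_setCost (I : STPathInstance V) {x : Sym2 V → ℝ} {p : Finset (Sym2 V) → ℝ}
    (hpx : Represents p x) : I.cost x = ∑ S ∈ spanningTrees V, p S * I.setCost S := by
  simp only [setCost, cost, Finset.mul_sum]
  rw [Finset.sum_comm]
  refine Finset.sum_congr rfl fun e he => ?_
  rw [hpx e he, Finset.mul_sum]
  exact Finset.sum_congr rfl fun S _ => by ring

/-- The missing amount of the tree `S` on the cut `C`. -/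
noncomputable def deficit (x : Sym2 V → ℝ) (β : ℝ) (γ : Finset (Sym2 V) → Sym2 V → ℝ)
    (ε : Finset (Sym2 V) → Finset (Sym2 V) → Sym2 V) (S C : Finset (Sym2 V)) : ℝ :=
  if Even (S ∩ C).card then
    β * (2 - vecSum x C) / (1 - 2 * β) -
      min (β * (2 - vecSum x C) / (1 - 2 * β)) (γ S (ε S C))
  else 0

theorem benefit_eq (x : Sym2 V → ℝ) (β : ℝ) (γ : Finset (Sym2 V) → Sym2 V → ℝ)
    (ε : Finset (Sym2 V) → Finset (Sym2 V) → Sym2 V) (S C : Finset (Sym2 V)) :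
    benefit x β γ ε S C =
      (if Even (S ∩ C).card then β * (2 - vecSum x C) / (1 - 2 * β) else 0)
        - deficit x β γ ε S C + if (S ∩ C).card = 1 then 1 - γ S (ε S C) else 0 := by
  unfold benefit deficit
  by_cases h : Even (S ∩ C).card
  · have h1 : (S ∩ C).card ≠ 1 := by rintro h1; rw [h1] at h; simp at h
    simp [h, h1]
  · simp [h]

/-- The right side of the benefit condition is what full benefit on all even trees would contribute;
cancelling it leaves deficits against single-edge savings. -/
theorem sum_deficit_le {x : Sym2 V → ℝ} {p : Finset (Sym2 V) → ℝ} {β : ℝ}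
    {γ : Finset (Sym2 V) → Sym2 V → ℝ} {ε : Finset (Sym2 V) → Finset (Sym2 V) → Sym2 V}
    {C : Finset (Sym2 V)}
    (h : β * (2 - vecSum x C) * pEven p C / (1 - 2 * β) ≤
        ∑ S ∈ spanningTrees V, p S * benefit x β γ ε S C) :
    ∑ S ∈ spanningTrees V, p S * deficit x β γ ε S C ≤
      ∑ S ∈ spanningTrees V, p S * if (S ∩ C).card = 1 then 1 - γ S (ε S C) else 0 := by
  simp only [benefit_eq, mul_add, mul_sub, Finset.sum_add_distrib, Finset.sum_sub_distrib] at h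
  have h1 : ∑ S ∈ spanningTrees V,
      p S * (if Even (S ∩ C).card then β * (2 - vecSum x C) / (1 - 2 * β) else 0)
      = β * (2 - vecSum x C) * pEven p C / (1 - 2 * β) := by
    simp only [mul_ite, mul_zero, pEven]
    rw [← Finset.sum_filter, ← Finset.sum_mul]
    ring
  rw [← mul_sub] at h
  linarith

theorem bomc_le_of_average (I : STPathInstance V) {p : Finset (Sym2 V) → ℝ}
    (hp : IsDistribution p) {b : Finset (Sym2 V) → ℝ} {B : ℝ}
    (hb : ∀ S ∈ spanningTrees V, ∃ J ∈ tJoins (I.wrongParity S), I.setCost J ≤ b S)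
    (havg : ∑ S ∈ spanningTrees V, p S * (I.setCost S + b S) ≤ B) :
    I.bomc p ≤ (B : WithTop ℝ) := by
  obtain ⟨S, hS, hpS, hle⟩ : ∃ S ∈ spanningTrees V, 0 < p S ∧ I.setCost S + b S ≤ B := by
    by_contra! hc
    have h1 : ∃ S ∈ spanningTrees V, 0 < p S := by
      by_contra! h
      have := Finset.sum_nonpos h
      linarith [hp.2]
    have h2 : ∑ S ∈ spanningTrees V, p S * B <
        ∑ S ∈ spanningTrees V, p S * (I.setCost S + b S) := by
      refine Finset.sum_lt_sum (fun S hS => ?_) ?_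
      · rcases (hp.1 S hS).eq_or_lt with h | h
        · simp [← h]
        · exact mul_le_mul_of_nonneg_left (hc S hS h).le h.le
      · obtain ⟨S, hS, h⟩ := h1
        exact ⟨S, hS, mul_lt_mul_of_pos_left (hc S hS h) h⟩
    rw [← Finset.sum_mul, hp.2, one_mul] at h2
    linarith
  obtain ⟨J, hJ, hJb⟩ := hb S hS
  refine (Finset.inf_le (b := S) (by simp [hS, hpS])).trans ?_
  refine (add_le_add le_rfl (Finset.inf_le hJ)).trans ?_
  rw [← WithTop.coe_add]
  exact WithTop.coe_le_coe.2 (by linarith)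

end STPathInstance

theorem lemma7 {V : Type*} [Fintype V] [DecidableEq V] (I : STPathInstance V)
    (x : Sym2 V → ℝ) (hx : I.Feasible x)
    (p : Finset (Sym2 V) → ℝ) (hp : STPathInstance.IsDistribution p)
    (hpx : STPathInstance.Represents p x)
    (ε : Finset (Sym2 V) → Finset (Sym2 V) → Sym2 V)
    (hε : ∀ S ∈ STPathInstance.spanningTrees V, ∀ C ∈ STPathInstance.narrowCuts x,
      ε S C ∈ I.pathEdges S ∩ C)
    (β : ℝ) (hβ₀ : 0 ≤ β) (hβ : β < 1 / 2)
    (γ : Finset (Sym2 V) → Sym2 V → ℝ)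
    (hγ : ∀ S ∈ STPathInstance.spanningTrees V, ∀ e ∈ I.pathEdges S, 0 ≤ γ S e ∧ γ S e ≤ 1)
    (hbenefit : ∀ C ∈ STPathInstance.narrowCuts x,
      β * (2 - STPathInstance.vecSum x C) * STPathInstance.pEven p C / (1 - 2 * β) ≤
        ∑ S ∈ STPathInstance.spanningTrees V, p S * STPathInstance.benefit x β γ ε S C) :
    I.bomc p ≤ (((2 - β) * I.cost x : ℝ) : WithTop ℝ) := by
  classical
  obtain ⟨S₀, hS₀⟩ : (STPathInstance.spanningTrees V).Nonempty := by
    rw [Finset.nonempty_iff_ne_empty]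
    intro h
    have := hp.2
    simp [h] at this
  have hB : 0 ≤ 1 - 2 * β := by linarith
  -- A cheapest edge of C does not depend on the tree, so the deficits of different trees on C can
  -- be averaged. Outside the narrow cuts the value is arbitrary.
  have hcheap : ∀ C : Finset (Sym2 V), ∃ f, C ∈ STPathInstance.narrowCuts x →
      f ∈ C ∧ ∀ e ∈ C, I.edgeCost f ≤ I.edgeCost e := by
    intro C
    by_cases hC : C ∈ STPathInstance.narrowCuts x
    · obtain ⟨f, hf⟩ := Finset.exists_min_image C I.edgeCost
        ⟨_, (Finset.mem_inter.1 (hε S₀ hS₀ C hC)).2⟩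
      exact ⟨f, fun _ => hf⟩
    · exact ⟨ε S₀ C, fun h => absurd h hC⟩
  choose m hm using hcheap
  have hcut : ∀ C ∈ STPathInstance.narrowCuts x, C ⊆ STPathInstance.edges V := by
    intro C hC
    obtain ⟨U, -, rfl⟩ := Finset.mem_image.1 hC
    exact STPathInstance.cut_subset_edges U
  let R := STPathInstance.deficit x β γ ε
  have hR : ∀ S C, 0 ≤ R S C := by
    intro S C
    simp only [R, STPathInstance.deficit]
    split_ifs
    · exact sub_nonneg.2 (min_le_left _ _)
    · exact le_rfl
  refine I.bomc_le_of_average hp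
    (b := fun S => I.cost (I.correction x β S (γ S) (STPathInstance.narrowCuts x) (R S) m))
    (fun S hS => ?_) ?_
  · refine I.exists_tJoin_le hS _ (fun e he => I.correction_nonneg hβ₀ hβ hx.nonneg
      (fun e he => (hγ S hS e he).1) (fun C _ => hR S C) he) fun U hU hU' hodd => ?_
    refine I.one_le_vecSum_correction hx hS hβ₀ hβ (hε S hS) (fun e he => (hγ S hS e he).1)
      (fun C _ => hR S C) (fun C _ heven => ?_) (fun C hC => (hm C hC).1) hU hU' hodd
    simp only [R, STPathInstance.deficit, if_pos heven]
    linarith [min_le_right (β * (2 - STPathInstance.vecSum x C) / (1 - 2 * β)) (γ S (ε S C))]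
  let D : Finset (Sym2 V) → ℝ := fun S =>
    ∑ C ∈ STPathInstance.narrowCuts x, R S C * I.edgeCost (m C)
  let A : Finset (Sym2 V) → ℝ := fun S => ∑ C ∈ STPathInstance.narrowCuts x,
    (if (S ∩ C).card = 1 then 1 - γ S (ε S C) else 0) * I.edgeCost (ε S C)
  -- After exchanging the sums, the benefit condition applies cut by cut, weighted with the cost of
  -- `m C`, which is at most that of `ε S C`.
  have hDA : ∑ S ∈ STPathInstance.spanningTrees V, p S * D S
      ≤ ∑ S ∈ STPathInstance.spanningTrees V, p S * A S := by
    simp only [D, A, Finset.mul_sum]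
    rw [Finset.sum_comm, Finset.sum_comm (s := STPathInstance.spanningTrees V)]
    refine Finset.sum_le_sum fun C hC => ?_
    have h1 := mul_le_mul_of_nonneg_right (STPathInstance.sum_deficit_le (hbenefit C hC))
      (I.edgeCost_nonneg (m C))
    simp only [Finset.sum_mul, mul_assoc] at h1
    refine h1.trans (Finset.sum_le_sum fun S hS => ?_)
    refine mul_le_mul_of_nonneg_left (mul_le_mul_of_nonneg_left ?_ ?_) (hp.1 S hS)
    · exact (hm C hC).2 _ (Finset.mem_inter.1 (hε S hS C hC)).2
    · split_ifs
      · linarith [(hγ S hS _ (Finset.mem_inter.1 (hε S hS C hC)).1).2]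
      · exact le_rfl
  -- The factor 2 - 2β is 1 for the tree itself plus 1 - 2β for its copy in the correction vector.
  have hterm : ∀ S ∈ STPathInstance.spanningTrees V,
      p S * (I.setCost S +
        I.cost (I.correction x β S (γ S) (STPathInstance.narrowCuts x) (R S) m))
      ≤ p S * (β * I.cost x) + (2 - 2 * β) * (p S * I.setCost S)
        + (1 - 2 * β) * (p S * D S - p S * A S) := by
    intro S hS
    have h1 := I.sum_released_le hS (hε S hS) (fun e he => (hγ S hS e he).2)
    rw [I.cost_correction (STPathInstance.mem_spanningTrees.1 hS).1
      (fun C hC => hcut C hC (hm C hC).1)]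
    have h2 := mul_le_mul_of_nonneg_left (mul_le_mul_of_nonneg_left h1 hB) (hp.1 S hS)
    simp only [D, A]
    linarith
  refine (Finset.sum_le_sum hterm).trans ?_
  rw [Finset.sum_add_distrib, Finset.sum_add_distrib, ← Finset.sum_mul, hp.2, ← Finset.mul_sum,
    ← Finset.mul_sum, ← I.cost_eq_sum_setCost hpx, Finset.sum_sub_distrib]
  have := mul_le_mul_of_nonneg_left hDA hB
  linarith
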